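/- **Proposition (tensor product in $\mathrm{ContLat}_*$).** For elements $x,y$ of a complete lattice $X$ write $y\succ x$ if, for every (nonempty) down-directed up-set $D\subseteq X$, $\bigwedge D\le x$ implies $y\in D$. An *op-continuous lattice* is a complete lattice $X$ such that $x=\bigwedge\{y\in X\mid y\succ x\}$ for every $x\in X$. Let $\mathrm{ContLat}_*$ be the category whose objects are the op-continuous lattices and whose morphisms are the maps preserving all suprema and all infima of (nonempty) down-directed subsets. For $X,Y,Z$ in $\mathrm{ContLat}_*$, a map $h:X\times Y\to Z$ is a *bimorphism* if it is a morphism of $\mathrm{ContLat}_*$ in each variable, i.e. $h(-,y):X\to Z$ and $h(x,-):Y\to Z$ are morphisms for all $x\in X$, $y\in Y$; write $\mathrm{Bimorph}(X\times Y,Z)$ for the set of these. Then $\mathrm{ContLat}_*$ admits a tensor product which represents bimorphisms. That is, for all $X,Y$ in $\mathrm{ContLat}_*$, the functor $$\mathrm{Bimorph}(X\times Y,-):\mathrm{ContLat}_*\to\mathrm{Set},$$ which acts on morphisms by post-composition, is representable by some object $X\otimes Y$ of $\mathrm{ContLat}_*$: there are bijections $\mathrm{ContLat}_*(X\otimes Y,Z)\cong\mathrm{Bimorph}(X\times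 Y,Z)$ natural in $Z$. -/

import Mathlib

open CategoryTheory

universe u

/-- `WayAbove y x` (written `y ≻ x`): whenever `D` is a (nonempty) down-directed up-set whose
infimum is below `x`, then `y ∈ D`. This is the order dual of the way-below relation. -/
def WayAbove {α : Type*} [CompleteLattice α] (y x : α) : Prop :=
  ∀ D : Set α, D.Nonempty → DirectedOn (· ≥ ·) D → IsUpperSet D → sInf D ≤ x → y ∈ D

/-- A complete lattice is op-continuous if every element is the infimum of the elements
way above it. -/
def IsOpContinuous (α : Type*) [CompleteLattice α] : Prop :=
  ∀ x : α, x = sInf {y : α | WayAbove y x}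

/-- A map between complete lattices that preserves all suprema and all infima of (nonempty)
down-directed sets. -/
structure PreservesSupDirInf {α β : Type*} [CompleteLattice α] [CompleteLattice β]
    (f : α → β) : Prop where
  map_sSup : ∀ s : Set α, f (sSup s) = sSup (f '' s)
  map_sInf : ∀ s : Set α, s.Nonempty → DirectedOn (· ≥ ·) s → f (sInf s) = sInf (f '' s)

namespace PreservesSupDirInf

variable {α β γ : Type*} [CompleteLattice α] [CompleteLattice β] [CompleteLattice γ]

theorem monotone {f : α → β} (hf : PreservesSupDirInf f) : Monotone f := by
  intro a b hab
  have h := hf.map_sSup {a, b}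
  rw [sSup_pair, sup_eq_right.mpr hab, Set.image_pair, sSup_pair] at h
  exact h ▸ le_sup_left

theorem id : PreservesSupDirInf (fun x : α => x) where
  map_sSup s := by simp
  map_sInf s _ _ := by simp

theorem comp {g : β → γ} {f : α → β} (hg : PreservesSupDirInf g) (hf : PreservesSupDirInf f) :
    PreservesSupDirInf (fun x => g (f x)) where
  map_sSup s := by rw [hf.map_sSup, hg.map_sSup, Set.image_image]
  map_sInf s hs hd := by
    have hd' : DirectedOn (· ≥ ·) (f '' s) := by
      rintro _ ⟨a, ha, rfl⟩ _ ⟨b, hb, rfl⟩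
      obtain ⟨c, hc, hac, hbc⟩ := hd a ha b hb
      exact ⟨f c, ⟨c, hc, rfl⟩, hf.monotone hac, hf.monotone hbc⟩
    rw [hf.map_sInf s hs hd, hg.map_sInf _ (hs.image f) hd', Set.image_image]

end PreservesSupDirInf

/-- An op-continuous lattice: an object of the category `ContLat_*`. -/
structure ContLatStar : Type (u + 1) where
  /-- The underlying set. -/
  carrier : Type u
  [str : CompleteLattice carrier]
  isOpContinuous : IsOpContinuous carrier

namespace ContLatStar

instance : CoeSort ContLatStar.{u} (Type u) := ⟨carrier⟩

instance instCompleteLattice (X : ContLatStar.{u}) : CompleteLattice X := X.str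

/-- Morphisms of `ContLat_*`: maps preserving all suprema and all down-directed infima. -/
@[ext]
structure Hom (X Y : ContLatStar.{u}) where
  /-- The underlying map. -/
  toFun : X → Y
  preserves : PreservesSupDirInf toFun

instance : Category.{u} ContLatStar.{u} where
  Hom X Y := Hom X Y
  id X := ⟨fun x => x, PreservesSupDirInf.id⟩
  comp f g := ⟨fun x => g.toFun (f.toFun x), g.preserves.comp f.preserves⟩

/-- Bimorphisms `X × Y → Z`: maps which are morphisms of `ContLat_*` in each variable. -/
@[ext]
structure Bimorph (X Y Z : ContLatStar.{u}) where
  /-- The underlying map. -/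
  toFun : X × Y → Z
  preserves_left : ∀ y : Y, PreservesSupDirInf fun x : X => toFun (x, y)
  preserves_right : ∀ x : X, PreservesSupDirInf fun y : Y => toFun (x, y)

/-- The functor `Bimorph(X × Y, -)` from `ContLat_*` to sets; a morphism `f : Z ⟶ Z'` acts by
sending a bimorphism `h` to `f ∘ h`. -/
def bimorphFunctor (X Y : ContLatStar.{u}) : ContLatStar.{u} ⥤ Type u where
  obj Z := Bimorph X Y Z
  map {Z Z'} f := TypeCat.ofHom fun h : Bimorph X Y Z =>
    (⟨fun p => Hom.toFun f (h.toFun p),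
      fun y => (Hom.preserves f).comp (h.preserves_left y),
      fun x => (Hom.preserves f).comp (h.preserves_right x)⟩ : Bimorph X Y Z')

end ContLatStar

/-!
A filter on a set `S` is the down-directed infimum of the principal filters of its members, and a
principal filter `𝓟 A` is the supremum of the filters `pure a`, `a ∈ A`. Hence a map on `Filter S`
preserving suprema and down-directed infima is determined by its values on the `pure a`, and it must
be `F ↦ limsup h F = ⨅ A ∈ F, ⨆ a ∈ A, h a`. Conversely, this formula does preserve suprema and
down-directed infima when its target is op-continuous (`preservesSupDirInf_limsup`): `Filter S` is
the free object of `ContLat_*` on `S`.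

The tensor product is the quotient of the free object on `X × Y` that identifies filters with the
same `limsup` along all bimorphisms `h : X × Y → Z`. It is realised as the set of closed elements of
the closure operator sending `F` to the largest filter `G` with `limsup h G ≤ limsup h F` for all
`h`; in this form it stays in the universe of `X` and `Y`, although `Z` ranges over a large
category. On it the maps `limsup h` preserve suprema and down-directed infima and together reflect
the order. Joint reflection gives op-continuity (`IsOpContinuous.of_jointly_reflecting`), the fact
that `(x, y) ↦ x ⊗ y` is a bimorphism, and the fact that each element is a down-directed infimum of
suprema of pure tensors, whence a morphism out of the tensor product is determined by its
restriction to pure tensors.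
-/

open Filter

/-! ### The relation `≻` and op-continuity -/

section WayAbove

variable {α β : Type*} [CompleteLattice α] [CompleteLattice β]

theorem le_of_forall_wayAbove (hα : IsOpContinuous α) {a b : α}
    (h : ∀ w, WayAbove w b → a ≤ w) : a ≤ b := by
  rw [hα b]
  exact le_sInf h

/-- The defining property of `w ≻ z`, for down-directed sets that need not be up-sets. -/
theorem WayAbove.exists_le {w z : α} (hw : WayAbove w z) {D : Set α} (hne : D.Nonempty)
    (hD : DirectedOn (· ≥ ·) D) (hz : sInf D ≤ z) : ∃ d ∈ D, d ≤ w := by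
  change w ∈ {a | ∃ d ∈ D, d ≤ a}
  refine hw _ ?_ ?_ ?_ ?_
  · obtain ⟨d, hd⟩ := hne
    exact ⟨d, d, hd, le_rfl⟩
  · rintro a ⟨d, hd, hda⟩ b ⟨e, he, heb⟩
    obtain ⟨c, hc, hcd, hce⟩ := hD d hd e he
    exact ⟨c, ⟨c, hc, le_rfl⟩, le_trans hcd hda, le_trans hce heb⟩
  · rintro a b hab ⟨d, hd, hda⟩
    exact ⟨d, hd, hda.trans hab⟩
  · exact le_trans (sInf_le_sInf fun d (hd : d ∈ D) => (⟨d, hd, le_rfl⟩ : ∃ e ∈ D, e ≤ d)) hz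

theorem WayAbove.le {w z : α} (hw : WayAbove w z) : z ≤ w := by
  obtain ⟨_, rfl, h⟩ := hw.exists_le (Set.singleton_nonempty z)
    (directedOn_singleton _) sInf_singleton.le
  exact h

theorem DirectedOn.image_of_monotone {f : α → β} {s : Set α} (hs : DirectedOn (· ≥ ·) s)
    (hf : Monotone f) : DirectedOn (· ≥ ·) (f '' s) := by
  rintro _ ⟨a, ha, rfl⟩ _ ⟨b, hb, rfl⟩
  obtain ⟨c, hc, hca, hcb⟩ := hs a ha b hb
  exact ⟨f c, ⟨c, hc, rfl⟩, hf hca, hf hcb⟩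

/-- The upper adjoint of `f` sends `w` to `sSup {y | f y ≤ w}`, which is way above `x` as soon as
`w ≻ f x`. -/
theorem PreservesSupDirInf.wayAbove_sSup {f : α → β} (hf : PreservesSupDirInf f) {x : α} {w : β}
    (hw : WayAbove w (f x)) : WayAbove (sSup {y | f y ≤ w}) x := by
  intro D hne hD hup hx
  have hz : sInf (f '' D) ≤ f x := by
    rw [← hf.map_sInf D hne hD]
    exact hf.monotone hx
  obtain ⟨_, ⟨d, hd, rfl⟩, hdw⟩ := hw.exists_le (hne.image f) (hD.image_of_monotone hf.monotone) hz
  exact hup (le_sSup hdw) hd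

/-- A complete lattice is op-continuous if it has a jointly order-reflecting family of maps to
op-continuous lattices that preserve suprema and down-directed infima. -/
theorem IsOpContinuous.of_jointly_reflecting {ι : Sort*} {β : ι → Type*}
    [∀ i, CompleteLattice (β i)] (hβ : ∀ i, IsOpContinuous (β i)) {f : ∀ i, α → β i}
    (hf : ∀ i, PreservesSupDirInf (f i)) (h : ∀ a b, (∀ i, f i a ≤ f i b) → a ≤ b) :
    IsOpContinuous α := by
  intro x
  refine le_antisymm (le_sInf fun y hy => WayAbove.le hy) (h _ _ fun i => ?_)
  refine le_of_forall_wayAbove (hβ i) fun w hw => ?_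
  calc f i (sInf {y | WayAbove y x})
      ≤ f i (sSup {y | f i y ≤ w}) := (hf i).monotone (sInf_le ((hf i).wayAbove_sSup hw))
    _ = sSup (f i '' {y | f i y ≤ w}) := (hf i).map_sSup _
    _ ≤ w := sSup_le (by rintro _ ⟨y, hy, rfl⟩; exact hy)

/-- Preservation of suprema and down-directed infima can be tested after composition with a jointly
order-reflecting family of maps that preserve them. -/
theorem PreservesSupDirInf.of_jointly_reflecting {γ ι : Type*} [CompleteLattice γ] {β : ι → Type*}
    [∀ i, CompleteLattice (β i)] {f : ∀ i, α → β i} (hf : ∀ i, PreservesSupDirInf (f i))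
    (h : ∀ a b, (∀ i, f i a ≤ f i b) → a ≤ b) {k : γ → α}
    (hk : ∀ i, PreservesSupDirInf fun x => f i (k x)) : PreservesSupDirInf k := by
  have h_eq : ∀ a b, (∀ i, f i a = f i b) → a = b := fun a b hab =>
    le_antisymm (h _ _ fun i => (hab i).le) (h _ _ fun i => (hab i).ge)
  have h_mono : Monotone k := fun a b hab => h _ _ fun i => (hk i).monotone hab
  refine ⟨fun s => h_eq _ _ fun i => ?_, fun s hne hd => h_eq _ _ fun i => ?_⟩
  · rw [(hf i).map_sSup, Set.image_image]
    exact (hk i).map_sSup s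
  · rw [(hf i).map_sInf _ (hne.image k) (hd.image_of_monotone h_mono), Set.image_image]
    exact (hk i).map_sInf s hne hd

end WayAbove

/-! ### Limits superior along filters -/

section Limsup

variable {S α : Type*} [CompleteLattice α]

theorem WayAbove.eventually_le {w z : α} (hw : WayAbove w z) {h : S → α} {F : Filter S}
    (hF : limsup h F ≤ z) : ∀ᶠ a in F, h a ≤ w := by
  obtain ⟨b, hb, hbw⟩ := hw.exists_le (D := {b | ∀ᶠ a in F, h a ≤ b})
    ⟨⊤, Eventually.of_forall fun _ => le_top⟩
    (fun b hb c hc => ⟨b ⊓ c, (hb.and hc).mono fun _ ha => le_inf ha.1 ha.2,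
      inf_le_left, inf_le_right⟩) hF
  exact hb.mono fun a ha => ha.trans hbw

theorem limsup_mono_filter {F G : Filter S} (h : S → α) (hFG : F ≤ G) :
    limsup h F ≤ limsup h G :=
  limsup_le_limsup_of_le hFG

theorem limsup_pure_eq (h : S → α) (a : S) : limsup h (pure a) = h a := by
  simp only [limsup_eq, eventually_pure]
  exact csInf_Ici

theorem preservesSupDirInf_limsup (hα : IsOpContinuous α) (h : S → α) :
    PreservesSupDirInf fun F : Filter S => limsup h F where
  map_sSup s := by
    refine le_antisymm (le_of_forall_wayAbove hα fun w hw => ?_) (sSup_le ?_)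
    · refine limsup_le_of_le (h := ?_)
      exact fun F hF => hw.eventually_le (le_sSup ⟨F, hF, rfl⟩)
    · rintro _ ⟨F, hF, rfl⟩
      exact limsup_mono_filter h (le_sSup hF)
  map_sInf s hne hd := by
    refine le_antisymm (le_sInf ?_) ?_
    · rintro _ ⟨F, hF, rfl⟩
      exact limsup_mono_filter h (sInf_le hF)
    · rw [limsup_eq (f := sInf s)]
      refine le_sInf fun w (hw : {a | h a ≤ w} ∈ sInf s) => ?_
      rw [sInf_eq_iInf, mem_biInf_of_directed hd hne] at hw
      obtain ⟨F, hF, hFw⟩ := hw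
      exact (sInf_le (Set.mem_image_of_mem _ hF)).trans (limsup_le_of_le (h := hFw))

end Limsup

/-! ### The tensor product -/

namespace ContLatStar

variable (X Y : ContLatStar.{u})

/-- The closure operator on filters on `X × Y` that sends `F` to the largest filter whose `limsup`
along every bimorphism is bounded by that of `F`. -/
noncomputable def tensorClosure : ClosureOperator (Filter (X × Y)) :=
  ClosureOperator.mk₂
    (fun F => sSup {G | ∀ (Z : ContLatStar.{u}) (h : Bimorph X Y Z),
      limsup h.toFun G ≤ limsup h.toFun F})
    (fun _ => le_sSup fun _ _ => le_rfl)
    (fun F G hFG => sSup_le fun H hH => le_sSup fun Z h => by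
      refine (hH Z h).trans ((limsup_mono_filter h.toFun hFG).trans ?_)
      rw [(preservesSupDirInf_limsup Z.isOpContinuous h.toFun).map_sSup]
      exact sSup_le (by rintro _ ⟨K, hK, rfl⟩; exact hK Z h))

/-- The underlying set of the tensor product: the closed elements of `tensorClosure X Y`, which
form a set of representatives for the filters modulo equality of `limsup` along all
bimorphisms. -/
abbrev TensorCarrier : Type u := (tensorClosure X Y).Closeds

noncomputable instance : CompleteLattice (TensorCarrier X Y) :=
  (tensorClosure X Y).gi.liftCompleteLattice

variable {X Y}

theorem limsup_tensorClosure {Z : ContLatStar.{u}} (h : Bimorph X Y Z) (F : Filter (X × Y)) :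
    limsup h.toFun (tensorClosure X Y F) = limsup h.toFun F := by
  refine le_antisymm ?_ (limsup_mono_filter _ ((tensorClosure X Y).le_closure F))
  refine ((preservesSupDirInf_limsup Z.isOpContinuous h.toFun).map_sSup _).trans_le ?_
  exact sSup_le (by rintro _ ⟨K, hK, rfl⟩; exact hK Z h)

/-- The extension of a bimorphism to the tensor product. -/
noncomputable def Bimorph.lift {Z : ContLatStar.{u}} (h : Bimorph X Y Z)
    (F : TensorCarrier X Y) : Z :=
  limsup h.toFun F.1

/-- The extensions of bimorphisms jointly reflect the order of the tensor product. -/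
theorem TensorCarrier.le_of_forall_lift_le {F G : TensorCarrier X Y}
    (hFG : ∀ (Z : ContLatStar.{u}) (h : Bimorph X Y Z), h.lift F ≤ h.lift G) : F ≤ G := by
  change F.1 ≤ G.1
  rw [← G.2.closure_eq]
  exact le_sSup hFG

theorem TensorCarrier.eq_of_forall_lift_eq {F G : TensorCarrier X Y}
    (hFG : ∀ (Z : ContLatStar.{u}) (h : Bimorph X Y Z), h.lift F = h.lift G) : F = G :=
  le_antisymm (le_of_forall_lift_le fun Z h => (hFG Z h).le)
    (le_of_forall_lift_le fun Z h => (hFG Z h).ge)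

/-- Suprema of closed filters are closures of suprema of filters, and infima of closed filters are
infima of filters; so the two preservation properties restrict from all filters. -/
theorem Bimorph.preservesSupDirInf_lift {Z : ContLatStar.{u}} (h : Bimorph X Y Z) :
    PreservesSupDirInf h.lift where
  map_sSup s := by
    have key : (sSup s).1 = tensorClosure X Y (sSup (Subtype.val '' s)) := rfl
    rw [Bimorph.lift, key, limsup_tensorClosure,
      (preservesSupDirInf_limsup Z.isOpContinuous h.toFun).map_sSup, Set.image_image]
    rfl
  map_sInf s hne hd := by
    have key : (sInf s).1 = sInf (Subtype.val '' s) := by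
      rw [(tensorClosure X Y).gi.gc.u_sInf, sInf_image]
    rw [Bimorph.lift, key, (preservesSupDirInf_limsup Z.isOpContinuous h.toFun).map_sInf _
      (hne.image _) (hd.image_of_monotone fun _ _ hab => hab), Set.image_image]
    rfl

variable (X Y) in
/-- The tensor product of op-continuous lattices. -/
noncomputable def tensor : ContLatStar.{u} where
  carrier := TensorCarrier X Y
  isOpContinuous :=
    IsOpContinuous.of_jointly_reflecting
      (ι := Σ Z : ContLatStar.{u}, Bimorph X Y Z) (β := fun i => i.1)
      (fun i => i.1.isOpContinuous) (f := fun i => i.2.lift)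
      (fun i => i.2.preservesSupDirInf_lift)
      (fun _ _ h => TensorCarrier.le_of_forall_lift_le fun Z k => h ⟨Z, k⟩)

/-- The pure tensor `x ⊗ y`. -/
noncomputable def tmul (p : X × Y) : TensorCarrier X Y :=
  (tensorClosure X Y).toCloseds (pure p)

@[simp]
theorem Bimorph.lift_tmul {Z : ContLatStar.{u}} (h : Bimorph X Y Z) (p : X × Y) :
    h.lift (tmul p) = h.toFun p :=
  (limsup_tensorClosure h _).trans (limsup_pure_eq _ _)

theorem preservesSupDirInf_of_lift {α : Type*} [CompleteLattice α] {k : α → TensorCarrier X Y}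
    (hk : ∀ (Z : ContLatStar.{u}) (h : Bimorph X Y Z), PreservesSupDirInf fun a => h.lift (k a)) :
    PreservesSupDirInf k :=
  PreservesSupDirInf.of_jointly_reflecting
    (ι := Σ Z : ContLatStar.{u}, Bimorph X Y Z) (β := fun i => i.1) (f := fun i => i.2.lift)
    (fun i => i.2.preservesSupDirInf_lift)
    (fun _ _ h => TensorCarrier.le_of_forall_lift_le fun Z k => h ⟨Z, k⟩)
    (fun i => hk i.1 i.2)

theorem TensorCarrier.directedOn_sSup_tmul (F : TensorCarrier X Y) :
    DirectedOn (· ≥ ·) ((fun A => sSup (tmul '' A)) '' F.1.sets) :=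
  DirectedOn.image_of_monotone
    (fun A hA B hB => ⟨A ∩ B, inter_mem hA hB, Set.inter_subset_left, Set.inter_subset_right⟩)
    (fun _ _ hAB => sSup_le_sSup (Set.image_mono hAB))

variable (X Y) in
/-- The universal bimorphism `(x, y) ↦ x ⊗ y`. -/
noncomputable def tensorBimorph : Bimorph X Y (tensor X Y) where
  toFun := tmul
  preserves_left y := preservesSupDirInf_of_lift fun Z h => by
    simpa only [h.lift_tmul] using h.preserves_left y
  preserves_right x := preservesSupDirInf_of_lift fun Z h => by
    simpa only [h.lift_tmul] using h.preserves_right x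

/-- The tensor product is generated by the pure tensors under suprema and down-directed infima. -/
theorem TensorCarrier.eq_sInf_sSup_tmul (F : TensorCarrier X Y) :
    F = sInf ((fun A => sSup (tmul '' A)) '' F.1.sets) := by
  refine eq_of_forall_lift_eq fun Z h => ?_
  rw [h.preservesSupDirInf_lift.map_sInf _ (Set.Nonempty.image _ ⟨_, F.1.univ_sets⟩)
    F.directedOn_sSup_tmul,
    Set.image_image]
  simp only [h.preservesSupDirInf_lift.map_sSup, Set.image_image, h.lift_tmul]
  rw [Bimorph.lift, limsup_eq_iInf_iSup]
  simp only [sInf_image, sSup_image, Filter.mem_sets]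

theorem PreservesSupDirInf.eq_of_eq_on_tmul {α : Type*} [CompleteLattice α]
    {f g : TensorCarrier X Y → α} (hf : PreservesSupDirInf f) (hg : PreservesSupDirInf g)
    (h : ∀ p, f (tmul p) = g (tmul p)) : f = g := by
  funext F
  rw [F.eq_sInf_sSup_tmul,
    hf.map_sInf _ (Set.Nonempty.image _ ⟨_, F.1.univ_sets⟩)
    F.directedOn_sSup_tmul,
    hg.map_sInf _ (Set.Nonempty.image _ ⟨_, F.1.univ_sets⟩) F.directedOn_sSup_tmul]
  simp only [Set.image_image, hf.map_sSup, hg.map_sSup, h]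

variable (X Y) in
/-- Restriction to pure tensors and extension of bimorphisms are mutually inverse. -/
noncomputable def corepresentableByTensor :
    (bimorphFunctor X Y).CorepresentableBy (tensor X Y) where
  homEquiv {Z} :=
    { toFun := fun g => (bimorphFunctor X Y).map g (tensorBimorph X Y)
      invFun := fun h => (⟨Bimorph.lift h, Bimorph.preservesSupDirInf_lift h⟩ : Hom (tensor X Y) Z)
      left_inv := fun g => Hom.ext (PreservesSupDirInf.eq_of_eq_on_tmul
        (Bimorph.preservesSupDirInf_lift _) (Hom.preserves g) fun p => Bimorph.lift_tmul _ p)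
      right_inv := fun h => Bimorph.ext (funext fun p => Bimorph.lift_tmul h p) }
  homEquiv_comp _ _ := rfl

end ContLatStar

/-- For all op-continuous lattices `X` and `Y`, the covariant functor `Bimorph(X × Y, -)` is
represented by some op-continuous lattice `X ⊗ Y`. -/
theorem mainTheorem9 (X Y : ContLatStar.{u}) :
    (ContLatStar.bimorphFunctor X Y).IsCorepresentable :=
  (ContLatStar.corepresentableByTensor X Y).isCorepresentable
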